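/- Let $B_{\max}\ge 0$ be an integer, $p_{10}\in[0,1)$ and $q\in[0,1]$. Consider the memoryless binary channel with $\Pr[Y=0\mid X=1]=p_{10}$ and $\Pr[Y=0\mid X=0]=1$, a receiver whose energy usage $Z_1,Z_2,\dots$ is i.i.d. $\mathrm{Ber}(q)$ and independent of everything else, and a battery with an arbitrary initial level $B_1\in\{0,\dots,B_{\max}\}$ and $$B_{i+1}=\min\bigl(B_{\max},(B_i+Y_i-Z_i)^+\bigr).$$ Let $O_i=1\{B_i=B_{\max},\,Y_i=1,\,Z_i=0\}$ and $U_i=1\{B_i=0,\,Y_i=0,\,Z_i=1\}$. For $p_x\in[0,1]$, the $\mathrm{Ber}(p_x)$ random code of rate $r$ has, at block length $n$, $\lceil 2^{nr}\rceil$ codewords whose letters are all i.i.d. $\mathrm{Ber}(p_x)$; a uniformly distributed message selects the codeword that is sent, and the decoder knows the codebook. It achieves $(r,P_{of},P_{uf})$ if there are decoders with $\Pr[\hat M\ne M]\to0$ as $n\to\infty$, and $$\limsup_{n\to\infty}\frac1n\sum_{i=1}^n \mathrm E[O_i]\le P_{of},\qquad \limsup_{n\to\infty}\frac1n\sum_{i=1}^n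 \mathrm E[U_i]\le P_{uf},$$ where probabilities and expectations are also taken over the random codebook. A triple $(R,P_{of},P_{uf})\in\mathbb R^3$ is achievable for unconstrained (i.i.d.) codes if there is a $p_x\in[0,1]$ such that, for every $r<R$, the $\mathrm{Ber}(p_x)$ random code of rate $r$ achieves $(r,P_{of},P_{uf})$. Then the set of achievable triples for unconstrained (i.i.d.) codes is $$\mathcal R=\Bigl\{(R,P_{of},P_{uf}):\ \exists\,p_y\in[0,1-p_{10}],\ R\le H(p_y)-\tfrac{p_y}{1-p_{10}}H(p_{10}),\ P_{of}\ge\pi_{B_{\max}}p_y(1-q),\ P_{uf}\ge\pi_0(1-p_y)q\Bigr\},$$ where $H(a)=-a\log_2a-(1-a)\log_2(1-a)$ and $$\pi_i=\frac{A^i}{\sum_{j=0}^{B_{\max}}A^j},\qquad A=\frac{p_y(1-q)}{(1-p_y)q},\qquad 0\le i\le B_{\max}$$ (when $(1-p_y)q=0<p_y(1-q)$ this is read as the limit $A\to\infty$, i.e. $\pi_{B_{\max}}=1$ and all other $\pi_i=0$; when $p_y=q\in\{0,1\}$ both energy bounds are read as $0$). Every triple that is achieved by a $\mathrm{Ber}(p_x)$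 random code with exactly $\lceil 2^{nR}\rceil$ codewords also lies in $\mathcal R$. Moreover, for every $p_y\in[0,1-p_{10}]$, except when $p_y=q\in\{0,1\}$, $\pi$ is the unique stationary distribution of the battery chain $B_i$ driven by independent i.i.d. sequences $Y_i\sim\mathrm{Ber}(p_y)$ and $Z_i\sim\mathrm{Ber}(q)$. -/

import Mathlib

open Filter Topology

noncomputable section

namespace EnergyInfo

/-- Binary entropy in bits (`Real.logb 2 0 = 0` gives the usual `0 log 0 = 0`). -/
def binH (a : ℝ) : ℝ := -a * Real.logb 2 a - (1 - a) * Real.logb 2 (1 - a)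

/-- Probability mass function of `Ber(p)` on `Bool` (`true` is the symbol 1). -/
def bern (p : ℝ) (b : Bool) : ℝ := if b then p else 1 - p

/-- Transition probability `Pr[Y = y | X = x]` of the binary channel: the symbol 1 becomes 0 with
probability `p10`, and the symbol 0 is always received as 0. -/
def channel (p10 : ℝ) (x y : Bool) : ℝ := if x then bern (1 - p10) y else bern 0 y

/-- A codebook with `M` binary codewords of length `n`. -/
abbrev Codebook (M n : ℕ) : Type := Fin M → Fin n → Bool

/-- Everything that is random in one block of length `n`: the codebook, the message, the received
word and the receiver's energy usage. -/
structure Outcome (M n : ℕ) where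
  /-- the codebook -/
  code : Codebook M n
  /-- the message -/
  msg : Fin M
  /-- the received word `Y^n` -/
  y : Fin n → Bool
  /-- the energy usage `Z^n` -/
  z : Fin n → Bool

/-- Joint probability mass function: the entries of the codebook are i.i.d. `Ber(px)`, the message
is uniform and independent of the codebook, the codeword of the message is sent over the memoryless
channel, and the energy usage is i.i.d. `Ber(q)`, independent of all the rest. -/
def prob (px p10 q : ℝ) {M n : ℕ} (ω : Outcome M n) : ℝ :=
  (∏ m, ∏ i, bern px (ω.code m i)) * (1 / (M : ℝ)) *
    (∏ i, channel p10 (ω.code ω.msg i) (ω.y i)) * ∏ i, bern q (ω.z i)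

/-- Expectation with respect to `prob` (a finite sum over all outcomes). -/
def expect (px p10 q : ℝ) {M n : ℕ} (f : Outcome M n → ℝ) : ℝ :=
  ∑ c : Codebook M n, ∑ m : Fin M, ∑ y : Fin n → Bool, ∑ z : Fin n → Bool,
    prob px p10 q ⟨c, m, y, z⟩ * f ⟨c, m, y, z⟩

/-- One step of the battery: `min (Bmax, (b + Y - Z)⁺)`; subtraction of natural numbers is
truncated at 0. -/
def batteryStep (Bmax b : ℕ) (y z : Bool) : ℕ := min Bmax (b + y.toNat - z.toNat)

/-- Battery level before time slot `i` of a block (slots are `0, …, n - 1`), from the initial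
level `b₀`. -/
def battery (Bmax b₀ : ℕ) {n : ℕ} (y z : Fin n → Bool) : ℕ → ℕ
  | 0 => b₀
  | i + 1 =>
    if h : i < n then batteryStep Bmax (battery Bmax b₀ y z i) (y ⟨i, h⟩) (z ⟨i, h⟩)
    else battery Bmax b₀ y z i

/-- Indicator of an overflow in slot `i`: the battery is full, `Y = 1` and `Z = 0`. -/
def overflowInd (Bmax b₀ : ℕ) {M n : ℕ} (i : Fin n) (ω : Outcome M n) : ℝ :=
  if battery Bmax b₀ ω.y ω.z i = Bmax ∧ ω.y i = true ∧ ω.z i = false then 1 else 0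

/-- Indicator of an underflow in slot `i`: the battery is empty, `Y = 0` and `Z = 1`. -/
def underflowInd (Bmax b₀ : ℕ) {M n : ℕ} (i : Fin n) (ω : Outcome M n) : ℝ :=
  if battery Bmax b₀ ω.y ω.z i = 0 ∧ ω.y i = false ∧ ω.z i = true then 1 else 0

/-- Number of messages at rate `R` (bits per channel use) and block length `n`. -/
def numMessages (R : ℝ) (n : ℕ) : ℕ := ⌈(2 : ℝ) ^ ((n : ℝ) * R)⌉₊

/-- Probability of overflow of the `Ber(px)` random code of rate `R`: the limit superior of the
average expected number of overflows per slot. -/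
def overflowProb (Bmax b₀ : ℕ) (px p10 q R : ℝ) : ℝ :=
  limsup (fun n : ℕ => (1 / (n : ℝ)) * ∑ i : Fin n,
    expect px p10 q (M := numMessages R n) (overflowInd Bmax b₀ i)) atTop

/-- Probability of underflow of the `Ber(px)` random code of rate `R`. -/
def underflowProb (Bmax b₀ : ℕ) (px p10 q R : ℝ) : ℝ :=
  limsup (fun n : ℕ => (1 / (n : ℝ)) * ∑ i : Fin n,
    expect px p10 q (M := numMessages R n) (underflowInd Bmax b₀ i)) atTop

/-- A decoder for codebooks with `M` words of length `n`; it knows the codebook. -/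
abbrev Decoder (M n : ℕ) : Type := Codebook M n → (Fin n → Bool) → Fin M

/-- Probability of a decoding error, averaged over the random code. -/
def errorProb (px p10 q : ℝ) {M n : ℕ} (dec : Decoder M n) : ℝ :=
  expect px p10 q (fun ω : Outcome M n => if dec ω.code ω.y ≠ ω.msg then 1 else 0)

/-- With exactly `⌈2 ^ (n R)⌉` messages at block length `n`, the `Ber(px)` random code is reliable
(for suitable decoders) and meets the overflow and underflow constraints. -/
def AchievedBy (Bmax b₀ : ℕ) (px p10 q R Pof Puf : ℝ) : Prop :=
  (∃ dec : (n : ℕ) → Decoder (numMessages R n) n,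
      Tendsto (fun n => errorProb px p10 q (dec n)) atTop (𝓝 0)) ∧
    overflowProb Bmax b₀ px p10 q R ≤ Pof ∧ underflowProb Bmax b₀ px p10 q R ≤ Puf

/-- The achievable triples `(R, Pof, Puf)` for i.i.d. codes, with the usual convention that a rate
is achievable if every smaller rate can be used reliably. -/
def achievableTriples (Bmax b₀ : ℕ) (p10 q : ℝ) : Set (ℝ × ℝ × ℝ) :=
  {t | ∃ px ∈ Set.Icc (0 : ℝ) 1, ∀ r < t.1, AchievedBy Bmax b₀ px p10 q r t.2.1 t.2.2}

/-- Transition probabilities of the battery level when `Y` is i.i.d. `Ber(py)` and `Z` is i.i.d.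
`Ber(q)`, independent of `Y`. -/
def batteryTransition (Bmax : ℕ) (py q : ℝ) (b b' : Fin (Bmax + 1)) : ℝ :=
  ∑ y : Bool, ∑ z : Bool,
    bern py y * bern q z * if batteryStep Bmax b y z = b' then 1 else 0

/-- `ν` is a stationary probability distribution of the battery chain. -/
def IsStationary (Bmax : ℕ) (py q : ℝ) (ν : Fin (Bmax + 1) → ℝ) : Prop :=
  (∀ b, 0 ≤ ν b) ∧ ∑ b, ν b = 1 ∧ ∀ b', ∑ b, ν b * batteryTransition Bmax py q b b' = ν b'

/-- The odds `A` of an upward against a downward move of the battery. -/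
def oddsA (py q : ℝ) : ℝ := py * (1 - q) / ((1 - py) * q)

/-- `A ^ i` times `((1 - py) q) ^ Bmax`, for `i ≤ Bmax`, without a division. -/
def weight (Bmax : ℕ) (py q : ℝ) (i : ℕ) : ℝ :=
  (py * (1 - q)) ^ i * ((1 - py) * q) ^ (Bmax - i)

/-- The steady-state probability `A ^ i / ∑ j ≤ Bmax, A ^ j` of level `i`, in a form that is also
right (the limit as `A → ∞`) when `(1 - py) q = 0 < py (1 - q)`. -/
def statProb (Bmax : ℕ) (py q : ℝ) (i : ℕ) : ℝ :=
  weight Bmax py q i / ∑ j ∈ Finset.range (Bmax + 1), weight Bmax py q j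

/-- The function `O(py)`. -/
def overflowFn (Bmax : ℕ) (py q : ℝ) : ℝ := statProb Bmax py q Bmax * py * (1 - q)

/-- The function `U(py)`. -/
def underflowFn (Bmax : ℕ) (py q : ℝ) : ℝ := statProb Bmax py q 0 * (1 - py) * q

/-- The explicit region of triples `(R, Pof, Puf)`. -/
def region (Bmax : ℕ) (p10 q : ℝ) : Set (ℝ × ℝ × ℝ) :=
  {t | ∃ py ∈ Set.Icc (0 : ℝ) (1 - p10),
    t.1 ≤ binH py - py / (1 - p10) * binH p10 ∧
      overflowFn Bmax py q ≤ t.2.1 ∧ underflowFn Bmax py q ≤ t.2.2}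

end EnergyInfo

end

namespace EnergyInfo

/-! With i.i.d. letters the codebook average decouples the two halves of the problem:
`expect_of_forall_y_z` shows that the received word and the energy usage are i.i.d. over the slots,
with `py = px * (1 - p10)`, whatever the rate. The energy bounds thus depend on `py` alone, and the
rate bound is the mutual information of the channel with input `Ber(px)`.

Energy: over any cut between levels `b` and `b + 1` the upward and downward crossings in `n` slots
differ by at most one. Hence the time averages of the level probabilities satisfy the cut equations
of a birth-death chain up to `1 / n` (`abs_cut_occupation_le`), and together with total mass 1 these
force the limit to be `statProb` (`tendsto_statProb_of_cut`). No ergodic theorem is needed, and the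
initial level drops out. Exact cut equations give uniqueness of the stationary law by the same
lemma.

Rate: two one-shot bounds, `errorProb_thresholdDecoder_le` and `le_errorProb`, compare the number of
messages with a threshold on the likelihood ratio of channel to output law. Chebyshev's inequality
for the information density turns them into direct part and converse. The converse concerns this
random code at the given `px`, so no maximisation over input laws appears. -/

/-- Expectation of `f` under the product of copies of the mass function `p` indexed by `ι`. -/
noncomputable def iidExpect {ι α : Type*} [Fintype ι] [DecidableEq ι] [Fintype α] (p : α → ℝ)
    (f : (ι → α) → ℝ) : ℝ :=
  ∑ w : ι → α, (∏ i, p (w i)) * f w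

/-! ### Expectations of i.i.d. words -/

section IidExpect

variable {ι α : Type*} [Fintype ι] [DecidableEq ι] [Fintype α] {p : α → ℝ}

theorem iidExpect_add (f g : (ι → α) → ℝ) :
    iidExpect p (fun w => f w + g w) = iidExpect p f + iidExpect p g := by
  simp only [iidExpect, mul_add, Finset.sum_add_distrib]

theorem iidExpect_sub (f g : (ι → α) → ℝ) :
    iidExpect p (fun w => f w - g w) = iidExpect p f - iidExpect p g := by
  simp only [iidExpect, mul_sub, Finset.sum_sub_distrib]

theorem iidExpect_mul_const (f : (ι → α) → ℝ) (a : ℝ) :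
    iidExpect p (fun w => f w * a) = iidExpect p f * a := by
  simp only [iidExpect, ← mul_assoc, Finset.sum_mul]

theorem iidExpect_sum {κ : Type*} (s : Finset κ) (f : κ → (ι → α) → ℝ) :
    iidExpect p (fun w => ∑ k ∈ s, f k w) = ∑ k ∈ s, iidExpect p (f k) := by
  simp only [iidExpect, Finset.mul_sum]
  exact Finset.sum_comm

/-- Words with a letter of mass zero add nothing to either side. The restriction to positive letters
lets later steps take logarithms of probabilities. -/
theorem iidExpect_mono (hp : ∀ a, 0 ≤ p a) {f g : (ι → α) → ℝ}
    (h : ∀ w, (∀ i, 0 < p (w i)) → f w ≤ g w) : iidExpect p f ≤ iidExpect p g := by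
  refine Finset.sum_le_sum fun w _ => ?_
  by_cases hw : ∀ i, 0 < p (w i)
  · exact mul_le_mul_of_nonneg_left (h w hw) (Finset.prod_nonneg fun i _ => hp _)
  · push Not at hw
    obtain ⟨i, hi⟩ := hw
    rw [Finset.prod_eq_zero (Finset.mem_univ i) (le_antisymm hi (hp _))]
    simp

theorem iidExpect_const (h1 : ∑ a, p a = 1) (a : ℝ) :
    iidExpect p (fun _ : ι → α => a) = a := by
  have h := (Finset.prod_univ_sum (fun _ : ι => (Finset.univ : Finset α)) fun _ a => p a)
  simp only [h1, Finset.prod_const_one, Fintype.piFinset_univ] at h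
  rw [iidExpect, ← Finset.sum_mul, ← h, one_mul]

/-- A function that ignores the coordinate `i` is independent of that coordinate. -/
theorem iidExpect_mul_coord (h1 : ∑ a, p a = 1) (i : ι) (f : (ι → α) → ℝ) (g : α → ℝ)
    (hf : ∀ w a, f (Function.update w i a) = f w) :
    iidExpect p (fun w => f w * g (w i)) = iidExpect p f * ∑ a, p a * g a := by
  -- An involution: swap coordinate `i` with an independent fresh letter. It preserves the product
  -- mass and turns `g (w i)` into `g` of the fresh letter.
  let e : (ι → α) × α ≃ (ι → α) × α :=
    { toFun := fun x => (Function.update x.1 i x.2, x.1 i)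
      invFun := fun x => (Function.update x.1 i x.2, x.1 i)
      left_inv := fun x => by simp
      right_inv := fun x => by simp }
  have hprod : ∀ (w : ι → α) (a : α),
      (∏ j, p (Function.update w i a j)) * p (w i) = (∏ j, p (w j)) * p a := by
    intro w a
    rw [Fintype.prod_eq_mul_prod_compl i, Fintype.prod_eq_mul_prod_compl i (fun j => p (w j))]
    have : ∏ j ∈ {i}ᶜ, p (Function.update w i a j) = ∏ j ∈ {i}ᶜ, p (w j) := by
      refine Finset.prod_congr rfl fun j hj => ?_
      rw [Function.update_of_ne (by simpa using hj)]
    rw [this, Function.update_self]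
    ring
  have hsum : ∑ x : (ι → α) × α, (∏ j, p (x.1 j)) * p x.2 * (f x.1 * g x.2) =
      ∑ x : (ι → α) × α, (∏ j, p (x.1 j)) * p x.2 * (f x.1 * g (x.1 i)) := by
    refine (Fintype.sum_equiv e _ _ fun x => ?_).symm
    simp only [e, Equiv.coe_fn_mk, hf, hprod]
  rw [Fintype.sum_prod_type, Fintype.sum_prod_type] at hsum
  rw [iidExpect, iidExpect, Finset.sum_mul]
  calc _ = ∑ w : ι → α, ∑ a, (∏ j, p (w j)) * p a * (f w * g (w i)) := by
        refine Finset.sum_congr rfl fun w _ => ?_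
        rw [← Finset.sum_mul, ← Finset.mul_sum, h1, mul_one]
    _ = ∑ w : ι → α, ∑ a, (∏ j, p (w j)) * p a * (f w * g a) := hsum.symm
    _ = _ := by
        refine Finset.sum_congr rfl fun w _ => ?_
        rw [Finset.mul_sum]
        exact Finset.sum_congr rfl fun a _ => by ring

theorem iidExpect_coord (h1 : ∑ a, p a = 1) (i : ι) (g : α → ℝ) :
    iidExpect p (fun w => g (w i)) = ∑ a, p a * g a := by
  have h := iidExpect_mul_coord h1 i (fun _ => 1) g fun _ _ => rfl
  simpa [iidExpect_const h1] using h

/-- The second moment of a sum of centred i.i.d. terms. -/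
theorem iidExpect_sum_sq (h1 : ∑ a, p a = 1) (g : α → ℝ) (hg : ∑ a, p a * g a = 0) :
    iidExpect p (fun w : ι → α => (∑ i, g (w i)) ^ 2) =
      Fintype.card ι * ∑ a, p a * g a ^ 2 := by
  have hij : ∀ i j : ι, iidExpect p (fun w : ι → α => g (w i) * g (w j)) =
      if i = j then ∑ a, p a * g a ^ 2 else 0 := by
    intro i j
    split_ifs with h
    · subst h
      rw [← iidExpect_coord h1 i]
      simp only [sq]
    · rw [iidExpect_mul_coord h1 j (fun w => g (w i)) g, hg, mul_zero]
      intro w a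
      rw [Function.update_of_ne h]
  simp only [sq, Finset.sum_mul_sum, iidExpect_sum]
  simp [hij, sq]

/-- Chebyshev's inequality for the mean of i.i.d. terms. -/
theorem iidExpect_chebyshev (hp : ∀ a, 0 ≤ p a) (h1 : ∑ a, p a = 1) (g : α → ℝ) {δ : ℝ}
    (hδ : 0 < δ) [Nonempty ι] (f : (ι → α) → ℝ)
    (hf1 : ∀ w, f w ≤ 1) (hf : ∀ w, (∀ i, 0 < p (w i)) →
      |∑ i, g (w i) - Fintype.card ι * ∑ a, p a * g a| < Fintype.card ι * δ → f w ≤ 0) :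
    iidExpect p f ≤
      (∑ a, p a * (g a - ∑ a, p a * g a) ^ 2) / δ ^ 2 / Fintype.card ι := by
  set m := ∑ a, p a * g a with hm
  have hc : ∑ a, p a * (g a - m) = 0 := by
    simp only [mul_sub, Finset.sum_sub_distrib, ← Finset.sum_mul, h1]
    rw [← hm]; ring
  have h2 := iidExpect_sum_sq (ι := ι) h1 _ hc
  have hN : (0 : ℝ) < Fintype.card ι := by exact_mod_cast Fintype.card_pos
  calc iidExpect p f
      ≤ iidExpect p (fun w : ι → α =>
          (∑ i, (g (w i) - m)) ^ 2 * (1 / ((Fintype.card ι : ℝ) * δ) ^ 2)) := by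
        refine iidExpect_mono hp fun w hw => ?_
        have hs : ∑ i, (g (w i) - m) = ∑ i, g (w i) - Fintype.card ι * m := by
          simp [Finset.sum_sub_distrib]
        rw [hs]
        by_cases h : |∑ i, g (w i) - Fintype.card ι * m| < Fintype.card ι * δ
        · exact (hf w hw h).trans (by positivity)
        · refine (hf1 w).trans ?_
          rw [mul_one_div, one_le_div (by positivity), ← sq_abs (_ - _)]
          exact pow_le_pow_left₀ (by positivity) (not_lt.1 h) 2
    _ = _ := by
        rw [iidExpect_mul_const, h2]
        field_simp

end IidExpect

/-- A double sum over a pair of words is a sum over words of pairs. -/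
theorem sum_sum_prod_eq_iidExpect {ι α β : Type*} [Fintype ι] [DecidableEq ι] [Fintype α]
    [Fintype β] (k : α × β → ℝ) (f : (ι → α) → (ι → β) → ℝ) :
    ∑ x, ∑ y, (∏ i, k (x i, y i)) * f x y =
      iidExpect k fun w => f (fun i => (w i).1) fun i => (w i).2 := by
  rw [iidExpect, ← Fintype.sum_prod_type' (fun x y => (∏ i, k (x i, y i)) * f x y)]
  exact (Fintype.sum_equiv (Equiv.arrowProdEquivProdArrow ι (fun _ => α) (fun _ => β)) _ _
    fun w => rfl).symm

/-! ### Laws of a single letter and of a single slot -/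

theorem bern_nonneg {p : ℝ} (hp : p ∈ Set.Icc (0 : ℝ) 1) (b : Bool) : 0 ≤ bern p b := by
  cases b <;> simp [bern, hp.1, hp.2]

theorem sum_bern (p : ℝ) : ∑ b, bern p b = 1 := by
  simp [bern]

/-- Joint law of one received symbol and one energy usage. -/
noncomputable def slotLaw (py q : ℝ) (a : Bool × Bool) : ℝ := bern py a.1 * bern q a.2

theorem sum_slotLaw (py q : ℝ) : ∑ a, slotLaw py q a = 1 := by
  simp only [slotLaw, Fintype.sum_prod_type, ← Finset.mul_sum, sum_bern, mul_one]

theorem slotLaw_nonneg {py q : ℝ} (hpy : py ∈ Set.Icc (0 : ℝ) 1) (hq : q ∈ Set.Icc (0 : ℝ) 1)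
    (a : Bool × Bool) : 0 ≤ slotLaw py q a :=
  mul_nonneg (bern_nonneg hpy _) (bern_nonneg hq _)

/-! ### The cut equations determine the stationary law -/

/-- Total weight of all battery levels. -/
noncomputable def totalWeight (Bmax : ℕ) (py q : ℝ) : ℝ :=
  ∑ j ∈ Finset.range (Bmax + 1), weight Bmax py q j

theorem weight_nonneg {py q : ℝ} (hpy : py ∈ Set.Icc (0 : ℝ) 1) (hq : q ∈ Set.Icc (0 : ℝ) 1)
    (Bmax i : ℕ) : 0 ≤ weight Bmax py q i := by
  have := hpy.1; have := sub_nonneg.2 hpy.2; have := hq.1; have := sub_nonneg.2 hq.2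
  unfold weight
  positivity

/-- The excluded pairs are exactly those where the battery can move neither up nor down. -/
theorem up_or_down_pos {py q : ℝ} (hpy : py ∈ Set.Icc (0 : ℝ) 1) (hq : q ∈ Set.Icc (0 : ℝ) 1)
    (h0 : ¬ (py = 0 ∧ q = 0)) (h1 : ¬ (py = 1 ∧ q = 1)) :
    0 < py * (1 - q) ∨ 0 < (1 - py) * q := by
  obtain ⟨a, b⟩ := hpy
  obtain ⟨c, d⟩ := hq
  rcases a.eq_or_lt with rfl | a
  · right
    have : 0 < q := lt_of_le_of_ne c fun h => h0 ⟨rfl, h.symm⟩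
    linarith
  · rcases d.eq_or_lt with rfl | d
    · right
      have : py < 1 := lt_of_le_of_ne b fun h => h1 ⟨h, rfl⟩
      linarith
    · left
      exact mul_pos a (by linarith)

theorem totalWeight_pos {py q : ℝ} (hpy : py ∈ Set.Icc (0 : ℝ) 1) (hq : q ∈ Set.Icc (0 : ℝ) 1)
    (h0 : ¬ (py = 0 ∧ q = 0)) (h1 : ¬ (py = 1 ∧ q = 1)) (Bmax : ℕ) :
    0 < totalWeight Bmax py q := by
  rcases up_or_down_pos hpy hq h0 h1 with h | h
  · refine Finset.sum_pos' (fun i _ => weight_nonneg hpy hq _ _) ⟨Bmax, by simp, ?_⟩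
    simpa [weight] using pow_pos h Bmax
  · refine Finset.sum_pos' (fun i _ => weight_nonneg hpy hq _ _) ⟨0, by simp, ?_⟩
    simpa [weight] using pow_pos h Bmax

theorem statProb_eq (Bmax : ℕ) (py q : ℝ) (i : ℕ) :
    statProb Bmax py q i = weight Bmax py q i / totalWeight Bmax py q := rfl

/-- With up rate `u` and down rate `d`, iterating the cut equations gives `u ^ k * a b ≈ d ^ k * a
(b + k)`, hence `weight j * a b ≈ weight b * a j`; summing over `j` isolates `a b`. Nothing is
divided by `u` or `d`, so either may vanish. The filter is `atTop` for time averages and `pure ()`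
for an exact stationary law. -/
theorem tendsto_statProb_of_cut {γ : Type*} {l : Filter γ} {py q : ℝ} {Bmax : ℕ}
    (hW : 0 < totalWeight Bmax py q) (a : ℕ → γ → ℝ)
    (hsum : ∀ᶠ n in l, ∑ j ∈ Finset.range (Bmax + 1), a j n = 1)
    (hcut : ∀ b < Bmax, Tendsto
      (fun n => py * (1 - q) * a b n - (1 - py) * q * a (b + 1) n) l (𝓝 0))
    {b : ℕ} (hb : b ≤ Bmax) : Tendsto (a b) l (𝓝 (statProb Bmax py q b)) := by
  set u := py * (1 - q) with hu
  set d := (1 - py) * q with hd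
  have key : ∀ k b, b + k ≤ Bmax →
      Tendsto (fun n => u ^ k * a b n - d ^ k * a (b + k) n) l (𝓝 0) := by
    intro k
    induction k with
    | zero => intro b _; simpa using tendsto_const_nhds
    | succ k ih =>
      intro b hbk
      have h := ((ih b (by omega)).const_mul u).add ((hcut (b + k) (by omega)).const_mul (d ^ k))
      simp only [mul_zero, add_zero] at h
      refine h.congr fun n => ?_
      rw [← add_assoc]
      ring
  have pair_le : ∀ i j, i ≤ j → j ≤ Bmax →
      Tendsto (fun n => weight Bmax py q j * a i n - weight Bmax py q i * a j n) l (𝓝 0) := by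
    intro i j hij hj
    obtain ⟨k, rfl⟩ := Nat.exists_eq_add_of_le hij
    -- This factor is what the weights of levels `i` and `i + k` have in common.
    have h := (key k i hj).const_mul (u ^ i * d ^ (Bmax - (i + k)))
    rw [mul_zero] at h
    refine h.congr fun n => ?_
    have hdk : d ^ (Bmax - i) = d ^ (Bmax - (i + k)) * d ^ k := by
      rw [← pow_add]; congr 1; omega
    simp only [weight, ← hu, ← hd, hdk, pow_add]
    ring
  have pair : ∀ j ∈ Finset.range (Bmax + 1),
      Tendsto (fun n => weight Bmax py q j * a b n - weight Bmax py q b * a j n) l (𝓝 0) := by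
    intro j hj
    have hj' : j ≤ Bmax := by simpa [Nat.lt_succ_iff] using hj
    rcases le_total b j with h | h
    · exact pair_le b j h hj'
    · have := (pair_le j b h hb).neg
      rw [neg_zero] at this
      exact this.congr fun n => by ring
  have h := tendsto_finsetSum _ pair
  simp only [Finset.sum_const_zero, Finset.sum_sub_distrib, ← Finset.sum_mul,
    ← Finset.mul_sum] at h
  have h2 : Tendsto (fun n => totalWeight Bmax py q * a b n) l (𝓝 (weight Bmax py q b)) := by
    have h3 := h.add_const (weight Bmax py q b)
    rw [zero_add] at h3
    refine h3.congr' ?_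
    filter_upwards [hsum] with n hn
    rw [hn, totalWeight]
    ring
  have h4 := h2.div_const (totalWeight Bmax py q)
  rw [← statProb_eq] at h4
  exact h4.congr fun n => by field_simp

/-! ### The stationary law of the battery chain -/

theorem batteryStep_le (Bmax b : ℕ) (y z : Bool) : batteryStep Bmax b y z ≤ Bmax :=
  min_le_left _ _

/-- Balance of the indicator of `c < level` over one step. -/
theorem batteryStep_cut {Bmax b c : ℕ} (_hb : b ≤ Bmax) (hc : c < Bmax) (y z : Bool) :
    (if c < batteryStep Bmax b y z then (1 : ℝ) else 0) - (if c < b then 1 else 0) =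
      (if b = c then 1 else 0) * (if y = true ∧ z = false then 1 else 0) -
        (if b = c + 1 then 1 else 0) * (if y = false ∧ z = true then 1 else 0) := by
  cases y <;> cases z <;> simp [batteryStep] <;> split_ifs <;> first | omega | simp

theorem sum_slotLaw_up (py q : ℝ) :
    ∑ a : Bool × Bool, slotLaw py q a * (if a.1 = true ∧ a.2 = false then 1 else 0) =
      py * (1 - q) := by
  simp [Fintype.sum_prod_type, slotLaw, bern]

theorem sum_slotLaw_down (py q : ℝ) :
    ∑ a : Bool × Bool, slotLaw py q a * (if a.1 = false ∧ a.2 = true then 1 else 0) =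
      (1 - py) * q := by
  simp [Fintype.sum_prod_type, slotLaw, bern]

theorem sum_batteryTransition_mul (Bmax : ℕ) (py q : ℝ) (b : Fin (Bmax + 1)) (h : ℕ → ℝ) :
    ∑ b' : Fin (Bmax + 1), batteryTransition Bmax py q b b' * h b' =
      ∑ a : Bool × Bool, slotLaw py q a * h (batteryStep Bmax b a.1 a.2) := by
  have hT : ∀ b' : Fin (Bmax + 1), batteryTransition Bmax py q b b' = ∑ a : Bool × Bool,
      slotLaw py q a * if batteryStep Bmax b a.1 a.2 = b' then 1 else 0 := fun b' => by
    rw [Fintype.sum_prod_type]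
    rfl
  simp only [hT, Finset.sum_mul]
  rw [Finset.sum_comm]
  refine Finset.sum_congr rfl fun a _ => ?_
  rw [Finset.sum_eq_single ⟨batteryStep Bmax b a.1 a.2, Nat.lt_succ_of_le (batteryStep_le _ _ _ _)⟩]
  · simp
  · intro b' _ hne
    rw [if_neg fun h => hne (Fin.ext h.symm)]
    simp
  · simp

/-- Under a stationary law every function of the level has zero mean drift; the indicators of `c <
level` turn this into the cut equations. -/
theorem IsStationary.eq_statProb {Bmax : ℕ} {py q : ℝ} (hW : 0 < totalWeight Bmax py q)
    {ν : Fin (Bmax + 1) → ℝ} (hν : IsStationary Bmax py q ν) (i : Fin (Bmax + 1)) :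
    ν i = statProb Bmax py q i := by
  obtain ⟨-, hs, hst⟩ := hν
  have htest : ∀ h : ℕ → ℝ, ∑ b, ν b *
      ∑ a, slotLaw py q a * (h (batteryStep Bmax b a.1 a.2) - h b) = 0 := by
    intro h
    have e1 : ∑ b' : Fin (Bmax + 1), ν b' * h b' = ∑ b, ν b *
        ∑ a, slotLaw py q a * h (batteryStep Bmax b a.1 a.2) := by
      simp only [← sum_batteryTransition_mul, Finset.mul_sum]
      rw [Finset.sum_comm]
      refine Finset.sum_congr rfl fun b' _ => ?_
      rw [← hst b', Finset.sum_mul]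
      exact Finset.sum_congr rfl fun b _ => by ring
    simp only [mul_sub, Finset.sum_sub_distrib, ← Finset.sum_mul, sum_slotLaw, one_mul]
    rw [← e1, sub_self]
  let a : ℕ → Unit → ℝ := fun j _ => if h : j < Bmax + 1 then ν ⟨j, h⟩ else 0
  have hval : ∀ j : Fin (Bmax + 1), a j () = ν j := fun j => dif_pos j.2
  have hpick : ∀ c, ∑ b : Fin (Bmax + 1), ν b * (if (b : ℕ) = c then (1 : ℝ) else 0) =
      a c () := by
    intro c
    by_cases hc : c < Bmax + 1
    · rw [Finset.sum_eq_single ⟨c, hc⟩]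
      · simp only [if_true, mul_one]
        exact (hval ⟨c, hc⟩).symm
      · intro b _ hne
        rw [if_neg fun h => hne (Fin.ext h), mul_zero]
      · simp
    · simp only [a, hc, dite_false]
      refine Finset.sum_eq_zero fun b _ => ?_
      rw [if_neg (by have := b.2; omega), mul_zero]
  have hlim := tendsto_statProb_of_cut (l := pure ()) hW a ?_ ?_ (Nat.lt_succ_iff.1 i.2)
  · rw [← hval]
    exact tendsto_nhds_unique (tendsto_pure_nhds _ _) hlim
  · simp only [eventually_pure]
    rw [← hs, Finset.sum_range]
    exact Finset.sum_congr rfl fun j _ => hval j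
  · intro c hc
    have h := htest fun b => if c < b then 1 else 0
    have hstep : ∀ b : Fin (Bmax + 1), ∑ x : Bool × Bool, slotLaw py q x *
        ((if c < batteryStep Bmax b x.1 x.2 then (1 : ℝ) else 0) - (if c < (b : ℕ) then 1 else 0)) =
        (if (b : ℕ) = c then 1 else 0) * (py * (1 - q)) -
          (if (b : ℕ) = c + 1 then 1 else 0) * ((1 - py) * q) := by
      intro b
      rw [← sum_slotLaw_up, ← sum_slotLaw_down, Finset.mul_sum, Finset.mul_sum,
        ← Finset.sum_sub_distrib]
      refine Finset.sum_congr rfl fun x _ => ?_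
      rw [batteryStep_cut (Nat.lt_succ_iff.1 b.2) hc]
      ring
    simp only [hstep] at h
    simp only [mul_sub, ← mul_assoc, Finset.sum_sub_distrib, ← Finset.sum_mul,
      hpick] at h
    have hz : ∀ x : Unit, py * (1 - q) * a c x - (1 - py) * q * a (c + 1) x = 0 := fun _ => by
      linarith
    simp only [hz]
    exact tendsto_const_nhds

theorem batteryTransition_of_lt {Bmax : ℕ} (py q : ℝ) {b b' : Fin (Bmax + 1)} (h : b < b') :
    batteryTransition Bmax py q b b' = if (b' : ℕ) = b + 1 then py * (1 - q) else 0 := by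
  have := b'.2
  have h' : (b : ℕ) < b' := h
  have e1 : ¬ min Bmax ((b : ℕ) + 1 - 1) = b' := by omega
  have e2 : ¬ min Bmax ((b : ℕ) + 0 - 0) = b' := by omega
  have e3 : ¬ min Bmax ((b : ℕ) + 0 - 1) = b' := by omega
  have e4 : min Bmax ((b : ℕ) + 1 - 0) = b' ↔ (b' : ℕ) = b + 1 := by omega
  simp only [batteryTransition, Fintype.sum_bool, batteryStep, bern, Bool.toNat_true,
    Bool.toNat_false, e1, e2, e3, e4]
  simp

theorem batteryTransition_of_gt {Bmax : ℕ} (py q : ℝ) {b b' : Fin (Bmax + 1)} (h : b' < b) :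
    batteryTransition Bmax py q b b' = if (b : ℕ) = b' + 1 then (1 - py) * q else 0 := by
  have := b.2
  have h' : (b' : ℕ) < b := h
  have e1 : ¬ min Bmax ((b : ℕ) + 1 - 1) = b' := by omega
  have e2 : ¬ min Bmax ((b : ℕ) + 0 - 0) = b' := by omega
  have e3 : min Bmax ((b : ℕ) + 0 - 1) = b' ↔ (b : ℕ) = b' + 1 := by omega
  have e4 : ¬ min Bmax ((b : ℕ) + 1 - 0) = b' := by omega
  simp only [batteryTransition, Fintype.sum_bool, batteryStep, bern, Bool.toNat_true,
    Bool.toNat_false, e1, e2, e3, e4]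
  simp

/-- Distinct levels communicate only if adjacent, and one step up replaces a factor `(1 - py) * q`
of the weight by `py * (1 - q)`. -/
theorem weight_detailed_balance {Bmax : ℕ} (py q : ℝ) (b b' : Fin (Bmax + 1)) :
    weight Bmax py q b * batteryTransition Bmax py q b b' =
      weight Bmax py q b' * batteryTransition Bmax py q b' b := by
  have key : ∀ b b' : Fin (Bmax + 1), b < b' →
      weight Bmax py q b * batteryTransition Bmax py q b b' =
        weight Bmax py q b' * batteryTransition Bmax py q b' b := by
    intro b b' h
    rw [batteryTransition_of_lt py q h, batteryTransition_of_gt py q h]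
    split_ifs with hs
    · have hb' := b'.2
      obtain ⟨k, hk⟩ : ∃ k, Bmax = (b : ℕ) + 1 + k := ⟨Bmax - (b + 1), by omega⟩
      have e1 : Bmax - (b : ℕ) = k + 1 := by omega
      have e2 : Bmax - ((b : ℕ) + 1) = k := by omega
      simp only [weight, hs, e1, e2, pow_succ]
      ring
    · simp
  rcases lt_trichotomy b b' with h | h | h
  · exact key b b' h
  · rw [h]
  · exact (key b' b h).symm

theorem isStationary_statProb {Bmax : ℕ} {py q : ℝ} (hpy : py ∈ Set.Icc (0 : ℝ) 1)
    (hq : q ∈ Set.Icc (0 : ℝ) 1) (hW : 0 < totalWeight Bmax py q) :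
    IsStationary Bmax py q fun i : Fin (Bmax + 1) => statProb Bmax py q i := by
  refine ⟨fun b => div_nonneg (weight_nonneg hpy hq _ _) hW.le, ?_, fun b' => ?_⟩
  · simp only [statProb_eq, ← Finset.sum_div]
    rw [div_eq_one_iff_eq hW.ne', totalWeight, Finset.sum_range]
  · simp only [statProb_eq, div_mul_eq_mul_div, weight_detailed_balance py q _ b',
      ← Finset.sum_div, ← Finset.mul_sum]
    have h := sum_batteryTransition_mul Bmax py q b' fun _ => 1
    simp only [mul_one, sum_slotLaw] at h
    rw [h, mul_one]

theorem statProb_eq_oddsA {Bmax : ℕ} {py q : ℝ} (hpy : py < 1) (hq : 0 < q) {i : ℕ}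
    (hi : i ≤ Bmax) : statProb Bmax py q i =
      oddsA py q ^ i / ∑ j ∈ Finset.range (Bmax + 1), oddsA py q ^ j := by
  have hd : 0 < (1 - py) * q := mul_pos (by linarith) hq
  have hw : ∀ j ≤ Bmax, weight Bmax py q j = oddsA py q ^ j * ((1 - py) * q) ^ Bmax := by
    intro j hj
    have e : ((1 - py) * q) ^ Bmax = ((1 - py) * q) ^ (Bmax - j) * ((1 - py) * q) ^ j := by
      rw [← pow_add, Nat.sub_add_cancel hj]
    have hj0 := (pow_pos hd j).ne'
    rw [weight, oddsA, div_pow, e]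
    generalize ((1 - py) * q) ^ j = D at *
    field_simp
  have hsum : totalWeight Bmax py q =
      (∑ j ∈ Finset.range (Bmax + 1), oddsA py q ^ j) * ((1 - py) * q) ^ Bmax := by
    rw [totalWeight, Finset.sum_mul]
    exact Finset.sum_congr rfl fun j hj => hw j (Nat.lt_succ_iff.1 (Finset.mem_range.1 hj))
  rw [statProb_eq, hw i hi, hsum, mul_div_mul_right _ _ (pow_pos hd _).ne']

/-! ### Reducing expectations over the random code -/

/-- Probability of the word `x` under i.i.d. `Ber(p)` letters. -/
noncomputable def wordLaw (p : ℝ) {n : ℕ} (x : Fin n → Bool) : ℝ := ∏ i, bern p (x i)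

/-- Probability of receiving `y` when the word `x` is sent. -/
noncomputable def wordChannel (p10 : ℝ) {n : ℕ} (x y : Fin n → Bool) : ℝ :=
  ∏ i, channel p10 (x i) (y i)

theorem wordLaw_nonneg {p : ℝ} (hp : p ∈ Set.Icc (0 : ℝ) 1) {n : ℕ} (x : Fin n → Bool) :
    0 ≤ wordLaw p x :=
  Finset.prod_nonneg fun _ _ => bern_nonneg hp _

theorem sum_wordLaw (p : ℝ) {n : ℕ} : ∑ x : Fin n → Bool, wordLaw p x = 1 := by
  have h := iidExpect_const (ι := Fin n) (sum_bern p) 1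
  simpa [iidExpect, wordLaw] using h

theorem channel_nonneg {p10 : ℝ} (hp : p10 ∈ Set.Icc (0 : ℝ) 1) (x y : Bool) :
    0 ≤ channel p10 x y := by
  have h1 : 1 - p10 ∈ Set.Icc (0 : ℝ) 1 := ⟨by linarith [hp.2], by linarith [hp.1]⟩
  cases x
  · exact bern_nonneg (by simp) y
  · exact bern_nonneg h1 y

theorem wordChannel_nonneg {p10 : ℝ} (hp : p10 ∈ Set.Icc (0 : ℝ) 1) {n : ℕ}
    (x y : Fin n → Bool) : 0 ≤ wordChannel p10 x y :=
  Finset.prod_nonneg fun _ _ => channel_nonneg hp _ _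

theorem sum_channel (p10 : ℝ) (x : Bool) : ∑ y, channel p10 x y = 1 := by
  cases x <;> exact sum_bern _

theorem sum_wordChannel (p10 : ℝ) {n : ℕ} (x : Fin n → Bool) :
    ∑ y, wordChannel p10 x y = 1 := by
  have h := Finset.prod_univ_sum (fun _ : Fin n => (Finset.univ : Finset Bool))
    fun i y => channel p10 (x i) y
  simp only [sum_channel, Finset.prod_const_one, Fintype.piFinset_univ] at h
  exact h.symm

theorem sum_bern_mul_channel (px p10 : ℝ) (y : Bool) :
    ∑ x, bern px x * channel p10 x y = bern (px * (1 - p10)) y := by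
  cases y <;> simp [bern, channel]
  ring

theorem sum_wordLaw_mul_wordChannel (px p10 : ℝ) {n : ℕ} (y : Fin n → Bool) :
    ∑ x, wordLaw px x * wordChannel p10 x y = wordLaw (px * (1 - p10)) y := by
  have h := Finset.prod_univ_sum (fun _ : Fin n => (Finset.univ : Finset Bool))
    fun i x => bern px x * channel p10 x (y i)
  simp only [sum_bern_mul_channel, Fintype.piFinset_univ, Finset.prod_mul_distrib] at h
  exact h.symm

theorem mul_mem_Icc {px p10 : ℝ} (hpx : px ∈ Set.Icc (0 : ℝ) 1) (hp : p10 ∈ Set.Icc (0 : ℝ) 1) :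
    px * (1 - p10) ∈ Set.Icc (0 : ℝ) 1 :=
  ⟨mul_nonneg hpx.1 (by linarith [hp.2]),
    mul_le_one₀ hpx.2 (by linarith [hp.2]) (by linarith [hp.1])⟩

theorem expect_eq (px p10 q : ℝ) {M n : ℕ} (f : Outcome M n → ℝ) :
    expect px p10 q f = iidExpect (wordLaw px) fun c : Codebook M n =>
      ∑ m, (∑ y, wordChannel p10 (c m) y * ∑ z, wordLaw q z * f ⟨c, m, y, z⟩) * (1 / (M : ℝ)) := by
  unfold expect iidExpect
  refine Finset.sum_congr rfl fun c _ => ?_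
  rw [Finset.mul_sum]
  refine Finset.sum_congr rfl fun m _ => ?_
  rw [Finset.sum_mul, Finset.mul_sum]
  refine Finset.sum_congr rfl fun y _ => ?_
  rw [Finset.mul_sum, Finset.sum_mul, Finset.mul_sum]
  refine Finset.sum_congr rfl fun z _ => ?_
  simp only [prob, wordLaw, wordChannel]
  ring

/-- The energy usage is independent of all that the decoder sees, so it sums out. -/
theorem expect_of_forall_z (px p10 q : ℝ) {M n : ℕ}
    (f : Codebook M n → Fin M → (Fin n → Bool) → ℝ) :
    expect px p10 q (fun ω : Outcome M n => f ω.code ω.msg ω.y) =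
      (∑ m, iidExpect (wordLaw px) fun c : Codebook M n =>
        ∑ y, wordChannel p10 (c m) y * f c m y) * (1 / (M : ℝ)) := by
  simp only [expect_eq, ← Finset.sum_mul, sum_wordLaw, one_mul, iidExpect_mul_const,
    iidExpect_sum]

/-- The received word and the energy usage are i.i.d. over the slots. -/
theorem expect_of_forall_y_z (px p10 q : ℝ) {M n : ℕ} (hM : M ≠ 0)
    (f : (Fin n → Bool) → (Fin n → Bool) → ℝ) :
    expect px p10 q (fun ω : Outcome M n => f ω.y ω.z) =
      iidExpect (slotLaw (px * (1 - p10)) q) fun w : Fin n → Bool × Bool =>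
        f (fun i => (w i).1) fun i => (w i).2 := by
  rw [← sum_sum_prod_eq_iidExpect (slotLaw (px * (1 - p10)) q) f, expect_eq]
  simp only [← Finset.sum_mul, iidExpect_mul_const, iidExpect_sum]
  -- Averaged over the codebook, the output law is the same for every message.
  have hm : ∀ m : Fin M, ∑ y, (iidExpect (wordLaw px) fun c : Codebook M n =>
      wordChannel p10 (c m) y) * ∑ z, wordLaw q z * f y z =
      ∑ y, wordLaw (px * (1 - p10)) y * ∑ z, wordLaw q z * f y z := fun m => by
    refine Finset.sum_congr rfl fun y _ => ?_
    rw [iidExpect_coord (sum_wordLaw px) m (fun x => wordChannel p10 x y),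
      sum_wordLaw_mul_wordChannel]
  simp only [hm, Finset.sum_const, Finset.card_univ, Fintype.card_fin, nsmul_eq_mul]
  have hM' : (M : ℝ) ≠ 0 := by exact_mod_cast hM
  rw [mul_one_div, mul_div_cancel_left₀ _ hM']
  refine Finset.sum_congr rfl fun y _ => ?_
  rw [Finset.mul_sum]
  refine Finset.sum_congr rfl fun z _ => ?_
  simp only [slotLaw, wordLaw, Finset.prod_mul_distrib]
  ring

/-! ### Long-run overflow and underflow -/

theorem battery_le {Bmax b₀ : ℕ} (hb₀ : b₀ ≤ Bmax) {n : ℕ} (y z : Fin n → Bool) (i : ℕ) :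
    battery Bmax b₀ y z i ≤ Bmax := by
  induction i with
  | zero => exact hb₀
  | succ i ih =>
    rw [battery]
    split_ifs
    · exact batteryStep_le _ _ _ _
    · exact ih

/-- Causality: it makes the level before slot `i` independent of the letters of slot `i`. -/
theorem battery_congr {Bmax b₀ : ℕ} {n : ℕ} {y z y' z' : Fin n → Bool} (i : ℕ)
    (h : ∀ j : Fin n, (j : ℕ) < i → y j = y' j ∧ z j = z' j) :
    battery Bmax b₀ y z i = battery Bmax b₀ y' z' i := by
  induction i with
  | zero => rfl
  | succ i ih =>
    have ih := ih fun j hj => h j (by omega)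
    rw [battery, battery, ih]
    split_ifs with hi
    · rw [(h ⟨i, hi⟩ (by simp)).1, (h ⟨i, hi⟩ (by simp)).2]
    · rfl

/-- Battery level before slot `i` as a function of the word of pairs (received, used). -/
def pairBattery (Bmax b₀ : ℕ) {n : ℕ} (w : Fin n → Bool × Bool) (i : ℕ) : ℕ :=
  battery Bmax b₀ (fun j => (w j).1) (fun j => (w j).2) i

theorem pairBattery_succ (Bmax b₀ : ℕ) {n : ℕ} (w : Fin n → Bool × Bool) (i : Fin n) :
    pairBattery Bmax b₀ w (i + 1) =
      batteryStep Bmax (pairBattery Bmax b₀ w i) (w i).1 (w i).2 := by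
  rw [pairBattery, battery, dif_pos i.2]
  rfl

theorem pairBattery_update (Bmax b₀ : ℕ) {n : ℕ} (w : Fin n → Bool × Bool) (i : Fin n)
    (a : Bool × Bool) :
    pairBattery Bmax b₀ (Function.update w i a) i = pairBattery Bmax b₀ w i := by
  refine battery_congr _ fun j hj => ?_
  rw [Function.update_of_ne (fun h => by simp [h] at hj)]
  exact ⟨rfl, rfl⟩

/-- Average over the slots of the probability that the battery level is `b`. -/
noncomputable def occupation (Bmax b₀ : ℕ) (py q : ℝ) (b n : ℕ) : ℝ :=
  (1 / (n : ℝ)) * ∑ i : Fin n, iidExpect (slotLaw py q) fun w : Fin n → Bool × Bool =>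
    if pairBattery Bmax b₀ w i = b then 1 else 0

theorem iidExpect_level_mul (Bmax b₀ : ℕ) (py q : ℝ) {n : ℕ} (i : Fin n) (b : ℕ)
    (g : Bool × Bool → ℝ) :
    iidExpect (slotLaw py q) (fun w : Fin n → Bool × Bool =>
        (if pairBattery Bmax b₀ w i = b then 1 else 0) * g (w i)) =
      iidExpect (slotLaw py q) (fun w : Fin n → Bool × Bool =>
        if pairBattery Bmax b₀ w i = b then 1 else 0) * ∑ a, slotLaw py q a * g a :=
  iidExpect_mul_coord (sum_slotLaw py q) i _ g fun w a => by rw [pairBattery_update]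

theorem sum_occupation {Bmax b₀ : ℕ} (hb₀ : b₀ ≤ Bmax) (py q : ℝ) {n : ℕ} (hn : n ≠ 0) :
    ∑ b ∈ Finset.range (Bmax + 1), occupation Bmax b₀ py q b n = 1 := by
  have h1 : ∀ w : Fin n → Bool × Bool, ∀ i : Fin n, ∑ b ∈ Finset.range (Bmax + 1),
      (if pairBattery Bmax b₀ w i = b then (1 : ℝ) else 0) = 1 := fun w i => by
    rw [Finset.sum_ite_eq, if_pos]
    exact Finset.mem_range.2 (Nat.lt_succ_of_le (battery_le hb₀ _ _ _))
  simp only [occupation]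
  rw [← Finset.mul_sum, Finset.sum_comm]
  simp only [← iidExpect_sum, h1, iidExpect_const (sum_slotLaw py q)]
  have : (n : ℝ) ≠ 0 := by exact_mod_cast hn
  simp [this]

theorem abs_cut_occupation_le {Bmax b₀ : ℕ} (hb₀ : b₀ ≤ Bmax) {py q : ℝ}
    (hpy : py ∈ Set.Icc (0 : ℝ) 1) (hq : q ∈ Set.Icc (0 : ℝ) 1) {b : ℕ} (hb : b < Bmax) (n : ℕ) :
    |py * (1 - q) * occupation Bmax b₀ py q b n -
      (1 - py) * q * occupation Bmax b₀ py q (b + 1) n| ≤ 1 / (n : ℝ) := by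
  -- The increment of this tail probability is the net flow across the cut above `b`; it telescopes,
  -- and `T` stays in `[0, 1]`.
  set T : ℕ → ℝ := fun i => iidExpect (slotLaw py q) fun w : Fin n → Bool × Bool =>
    if b < pairBattery Bmax b₀ w i then 1 else 0
  have hstep : ∀ i : Fin n, T (i + 1) - T i =
      iidExpect (slotLaw py q) (fun w : Fin n → Bool × Bool =>
        if pairBattery Bmax b₀ w i = b then 1 else 0) * (py * (1 - q)) -
      iidExpect (slotLaw py q) (fun w : Fin n → Bool × Bool =>
        if pairBattery Bmax b₀ w i = b + 1 then 1 else 0) * ((1 - py) * q) := by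
    intro i
    rw [← sum_slotLaw_up, ← sum_slotLaw_down, ← iidExpect_level_mul, ← iidExpect_level_mul,
      ← iidExpect_sub]
    simp only [← iidExpect_sub]
    congr 1
    funext w
    rw [pairBattery_succ]
    exact batteryStep_cut (battery_le hb₀ _ _ _) hb _ _
  have hsum : ∑ i : Fin n, (T (i + 1) - T i) = T n - T 0 := by
    rw [Fin.sum_univ_eq_sum_range (fun i => T (i + 1) - T i), Finset.sum_range_sub]
  have hT01 : ∀ i, 0 ≤ T i ∧ T i ≤ 1 := by
    intro i
    have hn := slotLaw_nonneg hpy hq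
    constructor
    · rw [← iidExpect_const (ι := Fin n) (sum_slotLaw py q) 0]
      exact iidExpect_mono hn fun w _ => by split_ifs <;> norm_num
    · rw [← iidExpect_const (ι := Fin n) (sum_slotLaw py q) 1]
      exact iidExpect_mono hn fun w _ => by split_ifs <;> norm_num
  have heq : py * (1 - q) * occupation Bmax b₀ py q b n -
      (1 - py) * q * occupation Bmax b₀ py q (b + 1) n = (1 / (n : ℝ)) * (T n - T 0) := by
    rw [← hsum]
    simp only [hstep, Finset.sum_sub_distrib, ← Finset.sum_mul, occupation]
    ring
  rw [heq, abs_mul, abs_of_nonneg (by positivity : (0 : ℝ) ≤ 1 / n)]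
  refine mul_le_of_le_one_right (by positivity) (abs_le.2 ⟨?_, ?_⟩) <;>
    linarith [(hT01 n).1, (hT01 n).2, (hT01 0).1, (hT01 0).2]

theorem tendsto_occupation {Bmax b₀ : ℕ} (hb₀ : b₀ ≤ Bmax) {py q : ℝ}
    (hpy : py ∈ Set.Icc (0 : ℝ) 1) (hq : q ∈ Set.Icc (0 : ℝ) 1)
    (hW : 0 < totalWeight Bmax py q) {b : ℕ} (hb : b ≤ Bmax) :
    Tendsto (occupation Bmax b₀ py q b) atTop (𝓝 (statProb Bmax py q b)) := by
  refine tendsto_statProb_of_cut hW (occupation Bmax b₀ py q) ?_ (fun c hc => ?_) hb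
  · filter_upwards [eventually_ne_atTop 0] with n hn using sum_occupation hb₀ py q hn
  · exact squeeze_zero_norm (abs_cut_occupation_le hb₀ hpy hq hc)
      tendsto_one_div_atTop_nhds_zero_nat

theorem numMessages_ne_zero (R : ℝ) (n : ℕ) : numMessages R n ≠ 0 :=
  (Nat.ceil_pos.2 (by positivity)).ne'

theorem mean_overflow_eq (Bmax b₀ : ℕ) (px p10 q R : ℝ) (n : ℕ) :
    (1 / (n : ℝ)) * ∑ i : Fin n,
      expect px p10 q (M := numMessages R n) (overflowInd Bmax b₀ i) =
    occupation Bmax b₀ (px * (1 - p10)) q Bmax n * (px * (1 - p10) * (1 - q)) := by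
  rw [occupation, mul_assoc, Finset.sum_mul]
  congr 1
  refine Finset.sum_congr rfl fun i _ => ?_
  rw [← sum_slotLaw_up (px * (1 - p10)) q, ← iidExpect_level_mul]
  refine (expect_of_forall_y_z px p10 q (numMessages_ne_zero R n) fun y z =>
    if battery Bmax b₀ y z i = Bmax ∧ y i = true ∧ z i = false then 1 else 0).trans ?_
  congr 1
  funext w
  rw [ite_zero_mul_ite_zero, mul_one]
  rfl

theorem mean_underflow_eq (Bmax b₀ : ℕ) (px p10 q R : ℝ) (n : ℕ) :
    (1 / (n : ℝ)) * ∑ i : Fin n,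
      expect px p10 q (M := numMessages R n) (underflowInd Bmax b₀ i) =
    occupation Bmax b₀ (px * (1 - p10)) q 0 n * ((1 - px * (1 - p10)) * q) := by
  rw [occupation, mul_assoc, Finset.sum_mul]
  congr 1
  refine Finset.sum_congr rfl fun i _ => ?_
  rw [← sum_slotLaw_down (px * (1 - p10)) q, ← iidExpect_level_mul]
  refine (expect_of_forall_y_z px p10 q (numMessages_ne_zero R n) fun y z =>
    if battery Bmax b₀ y z i = 0 ∧ y i = false ∧ z i = true then 1 else 0).trans ?_
  congr 1
  funext w
  rw [ite_zero_mul_ite_zero, mul_one]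
  rfl

theorem overflowProb_eq {Bmax b₀ : ℕ} (hb₀ : b₀ ≤ Bmax) {px p10 q : ℝ}
    (hpx : px ∈ Set.Icc (0 : ℝ) 1) (hp : p10 ∈ Set.Icc (0 : ℝ) 1) (hq : q ∈ Set.Icc (0 : ℝ) 1)
    (R : ℝ) : overflowProb Bmax b₀ px p10 q R = overflowFn Bmax (px * (1 - p10)) q := by
  have hpy := mul_mem_Icc hpx hp
  simp only [overflowProb, mean_overflow_eq, overflowFn, mul_assoc (statProb _ _ _ _)]
  -- If upward moves are impossible, both sides are 0 without any limit law. This covers the frozen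
  -- chains, where `totalWeight` may vanish.
  by_cases h0 : px * (1 - p10) * (1 - q) = 0
  · simp [h0]
  · refine (Tendsto.mul_const _ (tendsto_occupation hb₀ hpy hq ?_ le_rfl)).limsup_eq
    refine totalWeight_pos hpy hq (fun h => h0 ?_) (fun h => h0 ?_) _ <;> simp [h.1, h.2]

theorem underflowProb_eq {Bmax b₀ : ℕ} (hb₀ : b₀ ≤ Bmax) {px p10 q : ℝ}
    (hpx : px ∈ Set.Icc (0 : ℝ) 1) (hp : p10 ∈ Set.Icc (0 : ℝ) 1) (hq : q ∈ Set.Icc (0 : ℝ) 1)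
    (R : ℝ) : underflowProb Bmax b₀ px p10 q R = underflowFn Bmax (px * (1 - p10)) q := by
  have hpy := mul_mem_Icc hpx hp
  simp only [underflowProb, mean_underflow_eq, underflowFn, mul_assoc (statProb _ _ _ _)]
  by_cases h0 : (1 - px * (1 - p10)) * q = 0
  · simp [h0]
  · refine (Tendsto.mul_const _ (tendsto_occupation hb₀ hpy hq ?_ (Nat.zero_le _))).limsup_eq
    refine totalWeight_pos hpy hq (fun h => h0 ?_) (fun h => h0 ?_) _ <;> simp [h.1, h.2]

/-! ### One-shot bounds on the error probability of a random code -/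

/-- Probability that sent and received words satisfy `S`. -/
noncomputable def jointProb (px p10 : ℝ) {n : ℕ} (S : (Fin n → Bool) → (Fin n → Bool) → Prop) : ℝ :=
  open Classical in
  ∑ x, ∑ y, wordLaw px x * wordChannel p10 x y * if S x y then 1 else 0

theorem errorProb_eq (px p10 q : ℝ) {M n : ℕ} (dec : Decoder M n) :
    errorProb px p10 q dec = (∑ m, iidExpect (wordLaw px) fun c : Codebook M n =>
      ∑ y, wordChannel p10 (c m) y * if dec c y ≠ m then 1 else 0) * (1 / (M : ℝ)) :=
  expect_of_forall_z px p10 q fun c m y => if dec c y ≠ m then 1 else 0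

open Classical in
/-- The threshold decoder: the unique message whose codeword explains the received word better than
the output law does, by a factor above `θ`. -/
noncomputable def thresholdDecoder (px p10 θ : ℝ) {M n : ℕ} (hM : M ≠ 0) : Decoder M n :=
  fun c y =>
    if h : ∃ m, θ * wordLaw (px * (1 - p10)) y < wordChannel p10 (c m) y ∧
        ∀ m', θ * wordLaw (px * (1 - p10)) y < wordChannel p10 (c m') y → m' = m then h.choose
    else ⟨0, Nat.pos_of_ne_zero hM⟩

theorem thresholdDecoder_eq {px p10 θ : ℝ} {M n : ℕ} (hM : M ≠ 0) {c : Codebook M n}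
    {y : Fin n → Bool} {m : Fin M}
    (hm : θ * wordLaw (px * (1 - p10)) y < wordChannel p10 (c m) y)
    (hu : ∀ m', θ * wordLaw (px * (1 - p10)) y < wordChannel p10 (c m') y → m' = m) :
    thresholdDecoder px p10 θ hM c y = m := by
  have h : ∃ m, θ * wordLaw (px * (1 - p10)) y < wordChannel p10 (c m) y ∧
      ∀ m', θ * wordLaw (px * (1 - p10)) y < wordChannel p10 (c m') y → m' = m := ⟨m, hm, hu⟩
  rw [thresholdDecoder, dif_pos h]
  exact hu _ h.choose_spec.1

/-- Probability that an independent codeword passes the threshold test. -/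
theorem sum_independent_pair_le {px p10 θ : ℝ} (hpx : px ∈ Set.Icc (0 : ℝ) 1)
    (hp : p10 ∈ Set.Icc (0 : ℝ) 1) (hθ : 0 < θ) (n : ℕ) :
    ∑ y : Fin n → Bool, wordLaw (px * (1 - p10)) y * ∑ x, wordLaw px x *
      (if θ * wordLaw (px * (1 - p10)) y < wordChannel p10 x y then 1 else 0) ≤ 1 / θ := by
  simp only [Finset.mul_sum]
  rw [Finset.sum_comm]
  -- Change of measure: where the test passes, the output law is at most `wordChannel / θ`.
  calc _ ≤ ∑ x : Fin n → Bool, ∑ y, wordLaw px x * wordChannel p10 x y * (1 / θ) := by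
        refine Finset.sum_le_sum fun x _ => Finset.sum_le_sum fun y _ => ?_
        have hx := wordLaw_nonneg hpx x
        have hw := wordChannel_nonneg hp x y
        split_ifs with h
        · rw [mul_one, mul_one_div, le_div_iff₀ hθ]
          nlinarith [mul_le_mul_of_nonneg_left h.le hx]
        · simp only [mul_zero]
          positivity
    _ = 1 / θ := by
        simp only [← Finset.sum_mul, ← Finset.mul_sum, sum_wordChannel, mul_one, sum_wordLaw,
          one_mul]

theorem iidExpect_two_words (px p10 : ℝ) {M n : ℕ} {m m' : Fin M} (hm : m' ≠ m)
    (y : Fin n → Bool) (g : (Fin n → Bool) → ℝ) :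
    iidExpect (wordLaw px) (fun c : Codebook M n => wordChannel p10 (c m) y * g (c m')) =
      wordLaw (px * (1 - p10)) y * ∑ x, wordLaw px x * g x := by
  rw [iidExpect_mul_coord (sum_wordLaw px) m' (fun c => wordChannel p10 (c m) y) g fun c x => by
      rw [Function.update_of_ne hm.symm],
    iidExpect_coord (sum_wordLaw px) m (fun x => wordChannel p10 x y),
    sum_wordLaw_mul_wordChannel]

theorem iidExpect_word (px p10 : ℝ) {M n : ℕ} (m : Fin M)
    (S : (Fin n → Bool) → (Fin n → Bool) → Prop) [∀ x y, Decidable (S x y)] :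
    iidExpect (wordLaw px) (fun c : Codebook M n =>
      ∑ y, wordChannel p10 (c m) y * if S (c m) y then 1 else 0) = jointProb px p10 S := by
  rw [iidExpect_coord (sum_wordLaw px) m
    (fun x => ∑ y, wordChannel p10 x y * if S x y then 1 else 0), jointProb]
  refine Finset.sum_congr rfl fun x _ => ?_
  rw [Finset.mul_sum]
  refine Finset.sum_congr rfl fun y _ => ?_
  rw [mul_assoc]
  congr

/-- An error requires that the sent codeword fails the test or that one of the `M - 1` others
passes; each of these is independent of the output and passes with probability at most `1 / θ`. -/
theorem errorProb_thresholdDecoder_le {px p10 θ : ℝ} (q : ℝ) (hpx : px ∈ Set.Icc (0 : ℝ) 1)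
    (hp : p10 ∈ Set.Icc (0 : ℝ) 1) (hθ : 0 < θ) {M : ℕ} (hM : M ≠ 0) (n : ℕ) :
    errorProb px p10 q (thresholdDecoder px p10 θ hM : Decoder M n) ≤
      jointProb px p10 (fun x y : Fin n → Bool =>
        wordChannel p10 x y ≤ θ * wordLaw (px * (1 - p10)) y) + ((M : ℝ) - 1) / θ := by
  rw [errorProb_eq]
  set Q : (Fin n → Bool) → ℝ := wordLaw (px * (1 - p10)) with hQ
  have hM0 : (0 : ℝ) < M := by exact_mod_cast Nat.pos_of_ne_zero hM
  rw [mul_one_div, div_le_iff₀ hM0]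
  have hm : ∀ m : Fin M, iidExpect (wordLaw px) (fun c : Codebook M n =>
      ∑ y, wordChannel p10 (c m) y * if thresholdDecoder px p10 θ hM c y ≠ m then 1 else 0) ≤
      jointProb px p10 (fun x y : Fin n → Bool => wordChannel p10 x y ≤ θ * Q y) +
        ((M : ℝ) - 1) / θ := by
    intro m
    have hbound : ∀ c : Codebook M n,
        (∑ y, wordChannel p10 (c m) y *
          if thresholdDecoder px p10 θ hM c y ≠ m then (1 : ℝ) else 0) ≤
        (∑ y, wordChannel p10 (c m) y *
          if wordChannel p10 (c m) y ≤ θ * Q y then 1 else 0) +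
        ∑ m' ∈ Finset.univ.erase m, ∑ y, wordChannel p10 (c m) y *
          (if θ * Q y < wordChannel p10 (c m') y then 1 else 0) := by
      intro c
      rw [Finset.sum_comm (s := Finset.univ.erase m), ← Finset.sum_add_distrib]
      refine Finset.sum_le_sum fun y _ => ?_
      rw [← Finset.mul_sum, ← mul_add]
      refine mul_le_mul_of_nonneg_left ?_ (wordChannel_nonneg hp _ _)
      have hnn : (0 : ℝ) ≤ ∑ m' ∈ Finset.univ.erase m,
          (if θ * Q y < wordChannel p10 (c m') y then 1 else 0) :=
        Finset.sum_nonneg fun _ _ => by split_ifs <;> norm_num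
      by_cases h1 : wordChannel p10 (c m) y ≤ θ * Q y
      · rw [if_pos h1]
        split_ifs <;> linarith
      rw [if_neg h1, zero_add]
      by_cases h2 : ∀ m', θ * Q y < wordChannel p10 (c m') y → m' = m
      · rw [if_neg (not_not.2 (thresholdDecoder_eq hM (not_le.1 h1) h2))]
        exact hnn
      · push Not at h2
        obtain ⟨m', hlt, hne⟩ := h2
        refine le_trans ?_ (Finset.single_le_sum (fun _ _ => ?_)
          (Finset.mem_erase.2 ⟨hne, Finset.mem_univ m'⟩))
        · rw [if_pos hlt]
          split_ifs <;> norm_num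
        · split_ifs <;> norm_num
    refine (iidExpect_mono (wordLaw_nonneg hpx) fun c _ => hbound c).trans ?_
    rw [iidExpect_add, iidExpect_word px p10 m fun x y => wordChannel p10 x y ≤ θ * Q y,
      iidExpect_sum]
    refine add_le_add le_rfl ((Finset.sum_le_card_nsmul _ _ (1 / θ) fun m' hm' => ?_).trans ?_)
    · rw [iidExpect_sum]
      refine le_trans (le_of_eq ?_) (sum_independent_pair_le hpx hp hθ n)
      exact Finset.sum_congr rfl fun y _ => iidExpect_two_words px p10
        (Finset.ne_of_mem_erase hm') y fun x => if θ * Q y < wordChannel p10 x y then 1 else 0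
    · rw [Finset.card_erase_of_mem (Finset.mem_univ m), Finset.card_univ, Fintype.card_fin,
        nsmul_eq_mul, Nat.cast_pred (Nat.pos_of_ne_zero hM), mul_one_div]
  refine (Finset.sum_le_card_nsmul _ _ _ fun m _ => hm m).trans (le_of_eq ?_)
  rw [Finset.card_univ, Fintype.card_fin, nsmul_eq_mul, mul_comm]

/-- Correctly decoded mass either lies where the likelihood ratio exceeds `θ` or is at most `θ`
times the output law of the decoding region. The regions of different messages are disjoint, so the
second kind totals at most `θ` over all messages. -/
theorem le_errorProb {px p10 θ : ℝ} (q : ℝ) (hpx : px ∈ Set.Icc (0 : ℝ) 1)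
    (hp : p10 ∈ Set.Icc (0 : ℝ) 1) (hθ : 0 < θ) {M n : ℕ} (hM : M ≠ 0) (dec : Decoder M n) :
    1 - jointProb px p10 (fun x y : Fin n → Bool =>
        θ * wordLaw (px * (1 - p10)) y < wordChannel p10 x y) - θ / M ≤
      errorProb px p10 q dec := by
  rw [errorProb_eq]
  set Q : (Fin n → Bool) → ℝ := wordLaw (px * (1 - p10)) with hQ
  have hQ0 : ∀ y, 0 ≤ Q y := wordLaw_nonneg (mul_mem_Icc hpx hp)
  have hM0 : (0 : ℝ) < M := by exact_mod_cast Nat.pos_of_ne_zero hM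
  set J := jointProb px p10 (fun x y : Fin n → Bool => θ * Q y < wordChannel p10 x y) with hJ
  rw [mul_one_div, le_div_iff₀ hM0]
  have hpt : ∀ (c : Codebook M n) (m : Fin M), 1 ≤
      ∑ y, wordChannel p10 (c m) y * (if dec c y ≠ m then (1 : ℝ) else 0) +
      ∑ y, wordChannel p10 (c m) y * (if θ * Q y < wordChannel p10 (c m) y then 1 else 0) +
      ∑ y, (if dec c y = m then 1 else 0) * (θ * Q y) := by
    intro c m
    refine (sum_wordChannel p10 (c m)).symm.le.trans ?_
    rw [← Finset.sum_add_distrib, ← Finset.sum_add_distrib]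
    refine Finset.sum_le_sum fun y _ => ?_
    have hw := wordChannel_nonneg hp (c m) y
    have hq := mul_nonneg hθ.le (hQ0 y)
    by_cases h1 : dec c y = m <;> by_cases h2 : θ * Q y < wordChannel p10 (c m) y <;>
      simp only [h1, h2, ne_eq, not_true, not_false_eq_true, if_true, if_false] <;> linarith
  have hsum : (M : ℝ) ≤ ∑ m : Fin M, (iidExpect (wordLaw px) (fun c : Codebook M n =>
      ∑ y, wordChannel p10 (c m) y * if dec c y ≠ m then 1 else 0)) + M * J + θ := by
    calc (M : ℝ) = iidExpect (wordLaw px) (fun _ : Codebook M n => (M : ℝ)) :=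
          (iidExpect_const (sum_wordLaw px) _).symm
      _ ≤ iidExpect (wordLaw px) (fun c : Codebook M n => ∑ m,
            (∑ y, wordChannel p10 (c m) y * (if dec c y ≠ m then (1 : ℝ) else 0)) +
          ∑ m, ∑ y, wordChannel p10 (c m) y *
            (if θ * Q y < wordChannel p10 (c m) y then 1 else 0) + θ) := by
          refine iidExpect_mono (wordLaw_nonneg hpx) fun c _ => ?_
          have h := Finset.sum_le_sum fun m (_ : m ∈ Finset.univ) => hpt c m
          simp only [Finset.sum_add_distrib] at h
          have hθ' : ∑ m, ∑ y, (if dec c y = m then 1 else 0) * (θ * Q y) = θ := by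
            rw [Finset.sum_comm]
            simp only [← Finset.sum_mul, Finset.sum_ite_eq, Finset.mem_univ, if_true, one_mul,
              ← Finset.mul_sum, hQ, sum_wordLaw, mul_one]
          rw [hθ'] at h
          simpa using h
      _ = _ := by
          rw [iidExpect_add, iidExpect_add, iidExpect_sum, iidExpect_sum,
            iidExpect_const (sum_wordLaw px)]
          simp only [iidExpect_word px p10 _ fun x y => θ * Q y < wordChannel p10 x y, ← hJ]
          simp
  have : (1 - J - θ / M) * M = M - M * J - θ := by field_simp
  linarith

/-! ### Concentration of the information density -/

/-- Joint law of one sent and one received symbol. -/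
noncomputable def pairLaw (px p10 : ℝ) (a : Bool × Bool) : ℝ := bern px a.1 * channel p10 a.1 a.2

/-- Information density of one sent and one received symbol. -/
noncomputable def infoDensity (px p10 : ℝ) (a : Bool × Bool) : ℝ :=
  Real.logb 2 (channel p10 a.1 a.2) - Real.logb 2 (bern (px * (1 - p10)) a.2)

/-- Mutual information of the channel with a `Ber(px)` input. -/
noncomputable def mutualInfo (px p10 : ℝ) : ℝ := binH (px * (1 - p10)) - px * binH p10

theorem sum_pairLaw (px p10 : ℝ) : ∑ a, pairLaw px p10 a = 1 := by
  simp only [pairLaw, Fintype.sum_prod_type, ← Finset.mul_sum, sum_channel, mul_one, sum_bern]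

theorem pairLaw_nonneg {px p10 : ℝ} (hpx : px ∈ Set.Icc (0 : ℝ) 1) (hp : p10 ∈ Set.Icc (0 : ℝ) 1)
    (a : Bool × Bool) : 0 ≤ pairLaw px p10 a :=
  mul_nonneg (bern_nonneg hpx _) (channel_nonneg hp _ _)

/-- Input 0 is received without noise, so only input 1 contributes channel entropy. Where `channel`
is 0, the value `logb 2 0 = 0` is multiplied by mass 0. -/
theorem sum_pairLaw_mul_infoDensity (px p10 : ℝ) :
    ∑ a, pairLaw px p10 a * infoDensity px p10 a = mutualInfo px p10 := by
  simp only [Fintype.sum_prod_type, Fintype.sum_bool, pairLaw, infoDensity, mutualInfo, binH, bern,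
    channel, if_true, Bool.false_eq_true, if_false, Real.logb_one, sub_zero, sub_sub_cancel]
  ring

theorem jointProb_eq (px p10 : ℝ) {n : ℕ} (S : (Fin n → Bool) → (Fin n → Bool) → Prop)
    [∀ x y, Decidable (S x y)] :
    jointProb px p10 S = iidExpect (pairLaw px p10) fun w : Fin n → Bool × Bool =>
      if S (fun i => (w i).1) (fun i => (w i).2) then 1 else 0 := by
  rw [← sum_sum_prod_eq_iidExpect (pairLaw px p10) fun x y => if S x y then (1 : ℝ) else 0,
    jointProb]
  refine Finset.sum_congr rfl fun x _ => Finset.sum_congr rfl fun y _ => ?_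
  simp only [pairLaw, wordLaw, wordChannel, Finset.prod_mul_distrib]
  congr

theorem wordChannel_le_iff {px p10 : ℝ} (hpx : px ∈ Set.Icc (0 : ℝ) 1)
    (hp : p10 ∈ Set.Icc (0 : ℝ) 1) {n : ℕ} (w : Fin n → Bool × Bool)
    (hw : ∀ i, 0 < pairLaw px p10 (w i)) (t : ℝ) :
    wordChannel p10 (fun i => (w i).1) (fun i => (w i).2) ≤
        (2 : ℝ) ^ t * wordLaw (px * (1 - p10)) (fun i => (w i).2) ↔
      ∑ i, infoDensity px p10 (w i) ≤ t := by
  have hW : ∀ i, 0 < channel p10 (w i).1 (w i).2 := fun i =>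
    (channel_nonneg hp _ _).lt_of_ne fun h => by
      have := hw i
      simp [pairLaw, ← h] at this
  have hQ : ∀ i, 0 < bern (px * (1 - p10)) (w i).2 := fun i => by
    rw [← sum_bern_mul_channel]
    exact Finset.sum_pos' (fun x _ => pairLaw_nonneg hpx hp (x, (w i).2))
      ⟨(w i).1, Finset.mem_univ _, hw i⟩
  have hWn : 0 < wordChannel p10 (fun i => (w i).1) (fun i => (w i).2) :=
    Finset.prod_pos fun i _ => hW i
  have hQn : 0 < wordLaw (px * (1 - p10)) (fun i => (w i).2) := Finset.prod_pos fun i _ => hQ i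
  have h2 : (0 : ℝ) < 2 ^ t := by positivity
  rw [← Real.logb_le_logb (b := 2) (by norm_num) hWn (by positivity),
    Real.logb_mul h2.ne' hQn.ne', Real.logb_rpow (by norm_num) (by norm_num)]
  simp only [infoDensity, Finset.sum_sub_distrib, wordChannel, wordLaw]
  rw [Real.logb_prod _ _ fun i _ => (hW i).ne', Real.logb_prod _ _ fun i _ => (hQ i).ne',
    sub_le_iff_le_add]

/-- By Chebyshev's inequality the probability is at most a constant over `n`. -/
theorem tendsto_jointProb_of_infoDensity_atypical {px p10 δ : ℝ} (hpx : px ∈ Set.Icc (0 : ℝ) 1)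
    (hp : p10 ∈ Set.Icc (0 : ℝ) 1) (hδ : 0 < δ)
    (S : ∀ n : ℕ, (Fin n → Bool) → (Fin n → Bool) → Prop)
    (hS : ∀ n, ∀ w : Fin n → Bool × Bool, (∀ i, 0 < pairLaw px p10 (w i)) →
      |∑ i, infoDensity px p10 (w i) - n * mutualInfo px p10| < n * δ →
        ¬ S n (fun i => (w i).1) (fun i => (w i).2)) :
    Tendsto (fun n => jointProb px p10 (S n)) atTop (𝓝 0) := by
  classical
  refine tendsto_of_tendsto_of_tendsto_of_le_of_le' tendsto_const_nhds
    (tendsto_const_div_atTop_nhds_zero_nat ((∑ a, pairLaw px p10 a *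
      (infoDensity px p10 a - ∑ a, pairLaw px p10 a * infoDensity px p10 a) ^ 2) / δ ^ 2)) ?_ ?_
  · refine Eventually.of_forall fun n => ?_
    refine Finset.sum_nonneg fun x _ => Finset.sum_nonneg fun y _ => ?_
    have := wordLaw_nonneg hpx x
    have := wordChannel_nonneg hp x y
    split_ifs <;> positivity
  · filter_upwards [eventually_ne_atTop 0] with n hn
    have : Nonempty (Fin n) := Fin.pos_iff_nonempty.1 (Nat.pos_of_ne_zero hn)
    rw [jointProb_eq]
    have h := iidExpect_chebyshev (ι := Fin n) (pairLaw_nonneg hpx hp) (sum_pairLaw px p10)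
      (infoDensity px p10) hδ
      (fun w => if S n (fun i => (w i).1) (fun i => (w i).2) then 1 else 0)
      (fun w => by split_ifs <;> norm_num) (fun w hw hlt => by
        rw [Fintype.card_fin, sum_pairLaw_mul_infoDensity] at hlt
        rw [if_neg (hS n w hw hlt)])
    rwa [Fintype.card_fin] at h

theorem tendsto_jointProb_le {px p10 s : ℝ} (hpx : px ∈ Set.Icc (0 : ℝ) 1)
    (hp : p10 ∈ Set.Icc (0 : ℝ) 1) (hs : s < mutualInfo px p10) :
    Tendsto (fun n : ℕ => jointProb px p10 fun x y : Fin n → Bool => wordChannel p10 x y ≤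
      (2 : ℝ) ^ ((n : ℝ) * s) * wordLaw (px * (1 - p10)) y) atTop (𝓝 0) := by
  refine tendsto_jointProb_of_infoDensity_atypical hpx hp (sub_pos.2 hs) _ fun n w hw h => ?_
  rw [wordChannel_le_iff hpx hp w hw]
  have := (abs_lt.1 h).1
  linarith

theorem tendsto_jointProb_lt {px p10 s : ℝ} (hpx : px ∈ Set.Icc (0 : ℝ) 1)
    (hp : p10 ∈ Set.Icc (0 : ℝ) 1) (hs : mutualInfo px p10 < s) :
    Tendsto (fun n : ℕ => jointProb px p10 fun x y : Fin n → Bool =>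
      (2 : ℝ) ^ ((n : ℝ) * s) * wordLaw (px * (1 - p10)) y < wordChannel p10 x y)
      atTop (𝓝 0) := by
  refine tendsto_jointProb_of_infoDensity_atypical hpx hp (sub_pos.2 hs) _ fun n w hw h => ?_
  rw [not_lt, wordChannel_le_iff hpx hp w hw]
  have := (abs_lt.1 h).2
  linarith

/-! ### Reliable rates of a random code -/

theorem tendsto_two_rpow_neg {t : ℝ} (ht : t < 0) :
    Tendsto (fun n : ℕ => (2 : ℝ) ^ ((n : ℝ) * t)) atTop (𝓝 0) := by
  have h : ∀ n : ℕ, ((2 : ℝ) ^ t) ^ n = (2 : ℝ) ^ ((n : ℝ) * t) := fun n => by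
    rw [← Real.rpow_natCast, ← Real.rpow_mul (by norm_num), mul_comm]
  simp only [← h]
  exact tendsto_pow_atTop_nhds_zero_of_lt_one (by positivity)
    (Real.rpow_lt_one_of_one_lt_of_neg (by norm_num) ht)

theorem errorProb_nonneg {px p10 q : ℝ} (hpx : px ∈ Set.Icc (0 : ℝ) 1)
    (hp : p10 ∈ Set.Icc (0 : ℝ) 1) {M n : ℕ} (dec : Decoder M n) :
    0 ≤ errorProb px p10 q dec := by
  rw [errorProb_eq]
  refine mul_nonneg (Finset.sum_nonneg fun m _ => ?_) (by positivity)
  refine (iidExpect_const (ι := Fin M) (sum_wordLaw px (n := n)) 0).symm.le.trans ?_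
  refine iidExpect_mono (wordLaw_nonneg hpx) fun c _ => Finset.sum_nonneg fun y _ => ?_
  exact mul_nonneg (wordChannel_nonneg hp (c m) y) (by split_ifs <;> norm_num)

theorem exists_reliable_decoders {px p10 r : ℝ} (q : ℝ) (hpx : px ∈ Set.Icc (0 : ℝ) 1)
    (hp : p10 ∈ Set.Icc (0 : ℝ) 1) (hr : r < mutualInfo px p10) :
    ∃ dec : (n : ℕ) → Decoder (numMessages r n) n,
      Tendsto (fun n => errorProb px p10 q (dec n)) atTop (𝓝 0) := by
  obtain ⟨s, hrs, hs⟩ := exists_between hr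
  -- A threshold exponent strictly between rate and mutual information makes both error terms
  -- vanish.
  refine ⟨fun n => thresholdDecoder px p10 ((2 : ℝ) ^ ((n : ℝ) * s)) (numMessages_ne_zero r n), ?_⟩
  refine squeeze_zero (fun n => errorProb_nonneg hpx hp _) (fun n => ?_)
    (by simpa using (tendsto_jointProb_le hpx hp hs).add (tendsto_two_rpow_neg (sub_neg.2 hrs)))
  refine (errorProb_thresholdDecoder_le q hpx hp (Real.rpow_pos_of_pos two_pos _) _ n).trans ?_
  refine add_le_add le_rfl ?_
  rw [mul_sub, Real.rpow_sub (by norm_num)]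
  refine div_le_div_of_nonneg_right ?_ (by positivity)
  -- The sent codeword is not its own competitor: `M - 1` absorbs the rounding up of `2 ^ (n r)`.
  have := Nat.ceil_lt_add_one (by positivity : (0 : ℝ) ≤ 2 ^ ((n : ℝ) * r))
  rw [numMessages]
  linarith

theorem rate_le_mutualInfo {px p10 q R : ℝ} (hpx : px ∈ Set.Icc (0 : ℝ) 1)
    (hp : p10 ∈ Set.Icc (0 : ℝ) 1) (dec : (n : ℕ) → Decoder (numMessages R n) n)
    (h : Tendsto (fun n => errorProb px p10 q (dec n)) atTop (𝓝 0)) :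
    R ≤ mutualInfo px p10 := by
  by_contra! hR
  obtain ⟨s, hs, hsR⟩ := exists_between hR
  have hlim := ((tendsto_jointProb_lt hpx hp hs).const_sub 1).sub
    (tendsto_two_rpow_neg (sub_neg.2 hsR))
  have hle := le_of_tendsto_of_tendsto' hlim h fun n => ?_
  -- For `R` above the mutual information the lower bound tends to 1, the error to 0.
  · norm_num at hle
  · refine le_trans ?_ (le_errorProb q hpx hp
      (by positivity : (0 : ℝ) < 2 ^ ((n : ℝ) * s)) (numMessages_ne_zero R n) (dec n))
    refine sub_le_sub_left ?_ _
    rw [mul_sub, Real.rpow_sub (by norm_num)]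
    exact div_le_div_of_nonneg_left (by positivity) (by positivity) (Nat.le_ceil _)

/-! ### Assembling the region by the substitution `py = px * (1 - p10)` -/

theorem mem_region_of_le {Bmax : ℕ} {px p10 q R Pof Puf : ℝ} (hpx : px ∈ Set.Icc (0 : ℝ) 1)
    (hp : p10 ∈ Set.Ico (0 : ℝ) 1) (hR : R ≤ mutualInfo px p10)
    (ho : overflowFn Bmax (px * (1 - p10)) q ≤ Pof)
    (hu : underflowFn Bmax (px * (1 - p10)) q ≤ Puf) : (R, Pof, Puf) ∈ region Bmax p10 q := by
  have h1 : 0 < 1 - p10 := sub_pos.2 hp.2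
  refine ⟨px * (1 - p10), ⟨mul_nonneg hpx.1 h1.le, mul_le_of_le_one_left h1.le hpx.2⟩, ?_, ho, hu⟩
  rwa [mul_div_cancel_right₀ _ h1.ne']

theorem achievedBy_iff {Bmax b₀ : ℕ} (hb₀ : b₀ ≤ Bmax) {px p10 q : ℝ}
    (hpx : px ∈ Set.Icc (0 : ℝ) 1) (hp : p10 ∈ Set.Icc (0 : ℝ) 1) (hq : q ∈ Set.Icc (0 : ℝ) 1)
    (R Pof Puf : ℝ) : AchievedBy Bmax b₀ px p10 q R Pof Puf ↔
      (∃ dec : (n : ℕ) → Decoder (numMessages R n) n,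
        Tendsto (fun n => errorProb px p10 q (dec n)) atTop (𝓝 0)) ∧
      overflowFn Bmax (px * (1 - p10)) q ≤ Pof ∧ underflowFn Bmax (px * (1 - p10)) q ≤ Puf := by
  rw [AchievedBy, overflowProb_eq hb₀ hpx hp hq, underflowProb_eq hb₀ hpx hp hq]

theorem achievableTriples_eq_region {Bmax b₀ : ℕ} (hb₀ : b₀ ≤ Bmax) {p10 q : ℝ}
    (hp10 : p10 ∈ Set.Ico (0 : ℝ) 1) (hq : q ∈ Set.Icc (0 : ℝ) 1) :
    achievableTriples Bmax b₀ p10 q = region Bmax p10 q := by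
  have hp : p10 ∈ Set.Icc (0 : ℝ) 1 := Set.Ico_subset_Icc_self hp10
  ext ⟨R, Pof, Puf⟩
  constructor
  · rintro ⟨px, hpx, h⟩
    simp only [achievedBy_iff hb₀ hpx hp hq] at h
    -- The energy bounds do not involve the rate, so any one rate below `R` yields them.
    obtain ⟨-, ho, hu⟩ := h (R - 1) (by simp)
    refine mem_region_of_le hpx hp10 (le_of_forall_lt fun r hr => ?_) ho hu
    obtain ⟨r', hrr', hr'⟩ := exists_between hr
    obtain ⟨⟨dec, hdec⟩, -⟩ := h r' hr'
    exact hrr'.trans_le (rate_le_mutualInfo hpx hp dec hdec)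
  · rintro ⟨py, hpy, hR, ho, hu⟩
    have h1 : 0 < 1 - p10 := sub_pos.2 hp10.2
    have hpx : py / (1 - p10) ∈ Set.Icc (0 : ℝ) 1 :=
      ⟨div_nonneg hpy.1 h1.le, (div_le_one h1).2 hpy.2⟩
    have hmul : py / (1 - p10) * (1 - p10) = py := div_mul_cancel₀ _ h1.ne'
    refine ⟨py / (1 - p10), hpx, fun r hr => ?_⟩
    rw [achievedBy_iff hb₀ hpx hp hq, hmul]
    refine ⟨exists_reliable_decoders q hpx hp (hr.trans_le ?_), ho, hu⟩
    rwa [mutualInfo, hmul]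

end EnergyInfo

theorem lemma1 (Bmax b₀ : ℕ) (hb₀ : b₀ ≤ Bmax) (p10 q : ℝ) (hp10 : p10 ∈ Set.Ico (0 : ℝ) 1)
    (hq : q ∈ Set.Icc (0 : ℝ) 1) :
    EnergyInfo.achievableTriples Bmax b₀ p10 q = EnergyInfo.region Bmax p10 q ∧
    (∀ px ∈ Set.Icc (0 : ℝ) 1, ∀ R Pof Puf : ℝ,
      EnergyInfo.AchievedBy Bmax b₀ px p10 q R Pof Puf →
        (R, Pof, Puf) ∈ EnergyInfo.region Bmax p10 q) ∧
    (∀ py ∈ Set.Icc (0 : ℝ) (1 - p10),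
      (¬ (py = 0 ∧ q = 0) → ¬ (py = 1 ∧ q = 1) →
        ∀ ν : Fin (Bmax + 1) → ℝ, EnergyInfo.IsStationary Bmax py q ν ↔
          ν = fun i : Fin (Bmax + 1) => EnergyInfo.statProb Bmax py q (i : ℕ)) ∧
      (py < 1 → 0 < q → ∀ i ≤ Bmax, EnergyInfo.statProb Bmax py q i =
        EnergyInfo.oddsA py q ^ i /
          ∑ j ∈ Finset.range (Bmax + 1), EnergyInfo.oddsA py q ^ j)) := by
  have hp : p10 ∈ Set.Icc (0 : ℝ) 1 := Set.Ico_subset_Icc_self hp10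
  refine ⟨EnergyInfo.achievableTriples_eq_region hb₀ hp10 hq, ?_, fun py hpy => ⟨?_, ?_⟩⟩
  · intro px hpx R Pof Puf h
    rw [EnergyInfo.achievedBy_iff hb₀ hpx hp hq] at h
    obtain ⟨⟨dec, hdec⟩, ho, hu⟩ := h
    exact EnergyInfo.mem_region_of_le hpx hp10
      (EnergyInfo.rate_le_mutualInfo hpx hp dec hdec) ho hu
  · intro h0 h1 ν
    have hpy' : py ∈ Set.Icc (0 : ℝ) 1 := ⟨hpy.1, hpy.2.trans (by linarith [hp10.1])⟩
    have hW := EnergyInfo.totalWeight_pos hpy' hq h0 h1 Bmax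
    constructor
    · exact fun hν => funext (hν.eq_statProb hW)
    · rintro rfl
      exact EnergyInfo.isStationary_statProb hpy' hq hW
  · exact fun hpy1 hq0 i hi => EnergyInfo.statProb_eq_oddsA hpy1 hq0 hi
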